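/- Let $\mathbf{k}$ be a field with the discrete topology. A linearly topologized vector space is a $\mathbf{k}$-vector space with a Hausdorff, translation invariant topology that has a basis of neighbourhoods of $0$ consisting of linear subspaces; with continuous linear maps these form a category $\mathrm{Top}$. The completion of $V$ is $\widehat V=\lim_U V/U$ over all open linear subspaces $U\subset V$ (each $V/U$ being discrete), and $V$ is complete if the canonical map $V\to\widehat V$ is a topological isomorphism. The space $V$ is linearly compact if every family of closed cosets of linear subspaces of $V$ with the finite intersection property has nonempty intersection. It has a countable basis if $0$ has a countable neighbourhood basis of linear subspaces. "Countable" dimension includes finite dimension. Let $\mathcal I^\omega$ be the full subcategory of $\mathrm{Top}$ of spaces isomorphic to $\widehat{\operatorname{colim}A_i}$ for a direct system $(A_i)$ in $\mathrm{Top}$ indexed by $(\mathbb N,\le)$, with all $A_i$ linearly compact with countable basis (colimit in $\mathrm{Top}$). Let $\mathcal P^\omega$ be the full subcategory of spaces isomorphic to $\lim A_i$ for an inverse system $(A_i)$ in $\mathrm{Top}$ indexed by $(\mathbb N,\le)$, with all $A_i$ discrete of countable dimension (limit in $\mathrm{Top}$). A c-lattice in $V$ is a closed linear subspace $L\subset V$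 that is open and such that $\dim L/(L\cap U)<\infty$ for every open linear subspace $U\subset V$. A Tate vector space is a complete linearly topologized vector space that admits a c-lattice. Let $Tate^\omega$ be the full subcategory of Tate vector spaces that have a countable basis and admit a c-lattice of countable codimension. Then $$\mathcal I^\omega\cap\mathcal P^\omega=Tate^\omega .$$ -/

import Mathlib

open CategoryTheory

universe v u

namespace LinTop

/-! ### Linearly topologized vector spaces: unbundled notions -/

section Unbundled

variable (k : Type u) [Field k]
variable (V : Type v) [AddCommGroup V] [Module k V] [TopologicalSpace V]

/-- The index set of open linear subspaces of `V`. -/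
abbrev OpenSub : Type v := {U : Submodule k V // IsOpen (U : Set V)}

/-- The completion `lim_U V / U`, where `U` runs over all open linear subspaces of `V`: the linear
subspace of compatible families in the product `∏_U V / U`. It carries the subspace topology of the
product topology; each factor `V / U` carries the quotient topology, which is discrete as `U` is
open. -/
def Completion : Submodule k ((U : OpenSub k V) → V ⧸ U.1) where
  carrier := {x | ∀ (U U' : OpenSub k V) (h : U.1 ≤ U'.1), Submodule.factor h (x U) = x U'}
  add_mem' hx hy U U' h := by
    simp only [Pi.add_apply, map_add, hx U U' h, hy U U' h]
  zero_mem' U U' h := by simp only [Pi.zero_apply, map_zero]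
  smul_mem' c x hx U U' h := by
    simp only [Pi.smul_apply, map_smul, hx U U' h]

/-- The canonical linear map from `V` to its completion. -/
def toCompletion : V →ₗ[k] Completion k V where
  toFun x := ⟨fun U => U.1.mkQ x, fun _ _ _ => rfl⟩
  map_add' _ _ := rfl
  map_smul' _ _ := rfl

/-- `V` is complete if the canonical (linear) map to its completion is a topological
isomorphism. -/
def IsComplete : Prop := IsHomeomorph (toCompletion k V)

/-- Linear compactness: any family of closed linear varieties (cosets of linear subspaces) all of
whose finite subfamilies have a common point has a common point. -/
def IsLinearlyCompact : Prop :=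
  ∀ 𝒮 : Set (Set V),
    (∀ S ∈ 𝒮, IsClosed S ∧ ∃ (x : V) (H : Submodule k V), S = (fun h => x + h) '' (H : Set V)) →
    (∀ 𝒯 : Set (Set V), 𝒯 ⊆ 𝒮 → 𝒯.Finite → (⋂₀ 𝒯).Nonempty) →
    (⋂₀ 𝒮).Nonempty

/-- `V` has a countable basis of linear neighbourhoods of `0`. -/
def HasCountableBasis : Prop :=
  ∃ 𝓑 : Set (Submodule k V), 𝓑.Countable ∧
    (nhds (0 : V)).HasBasis (fun U => U ∈ 𝓑) (fun U => (U : Set V))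

/-- `V` has countable (that is, finite or countably infinite) dimension. -/
def HasCountableDim : Prop := Module.rank k V ≤ Cardinal.aleph0

variable {k V}

/-- A linear subspace `L` is linearly bounded if `L / (L ∩ U)` is finite-dimensional for each open
linear subspace `U`. -/
def IsLinearlyBounded (L : Submodule k V) : Prop :=
  ∀ U : Submodule k V, IsOpen (U : Set V) → Module.Finite k (L ⧸ U.comap L.subtype)

/-- A c-lattice is a closed linear subspace which is open and linearly bounded. -/
structure IsCLattice (L : Submodule k V) : Prop where
  isClosed : IsClosed (L : Set V)
  isOpen : IsOpen (L : Set V)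
  linearlyBounded : IsLinearlyBounded L

variable (k V)

/-- A Tate vector space is complete and admits a c-lattice. -/
def IsTate : Prop := IsComplete k V ∧ ∃ L : Submodule k V, IsCLattice L

/-- A Tate space with a countable basis and a c-lattice of countable codimension. -/
def IsTateOmega : Prop :=
  IsTate k V ∧ HasCountableBasis k V ∧
    ∃ L : Submodule k V, IsCLattice L ∧ HasCountableDim k (V ⧸ L)

end Unbundled

/-! ### The category of linearly topologized vector spaces and its full subcategories -/

section Categories

variable (k : Type u) [Field k] [TopologicalSpace k]

/-- Topological vector spaces that are Hausdorff and have a basis of neighbourhoods of `0`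
consisting of linear subspaces. -/
def linearlyTopologized : ObjectProperty (TopModuleCat.{v} k) :=
  fun V => T2Space V ∧ IsLinearTopology k V

/-- The category of linearly topologized vector spaces over `k` (to be used with the discrete
topology on `k`), with the continuous linear maps as morphisms. -/
abbrev Space : Type (max u (v + 1)) := (linearlyTopologized.{v} k).FullSubcategory

/-- Linearly compact spaces with countable basis. -/
def linearlyCompactOmega : ObjectProperty (Space.{v} k) :=
  fun V => IsLinearlyCompact k V.obj ∧ HasCountableBasis k V.obj

/-- Discrete spaces of countable dimension. -/
def discreteOmega : ObjectProperty (Space.{v} k) :=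
  fun V => DiscreteTopology V.obj ∧ HasCountableDim k V.obj

/-- `A` is ind-omega-linearly compact if it is (topologically linearly isomorphic to) the completion
of a colimit `C`, in the category of linearly topologized vector spaces, of a direct system indexed
by `(ℕ, ≤)` of linearly compact spaces with countable bases. -/
def indOmegaLinearlyCompact : ObjectProperty (Space.{v} k) :=
  fun A => ∃ C : Space.{v} k,
    (linearlyCompactOmega.{v} k).colimitsOfShape ℕ C ∧ Nonempty (A.obj ≃L[k] Completion k C.obj)

/-- `A` is pro-omega-discrete if it is a limit, in the category of linearly topologized vector
spaces, of an inverse system indexed by `(ℕ, ≤)` of discrete spaces of countable dimension. -/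
def proOmegaDiscrete : ObjectProperty (Space.{v} k) :=
  (discreteOmega.{v} k).limitsOfShape ℕᵒᵖ

/-- The Tate spaces with a countable basis and a c-lattice of countable codimension. -/
def tateOmega : ObjectProperty (Space.{v} k) :=
  fun A => IsTateOmega k A.obj

end Categories

end LinTop

/-! Everything is expressed through filtrations: decreasing sequences `U n` of open subspaces,
cofinal among the open ones. A countable limit of discrete spaces of countable dimension is the same
thing as a complete space with a filtration whose quotients `V ⧸ U n` have countable dimension.

From Tate to both classes: a c-lattice `L` has finite-dimensional image in each `V ⧸ U n`, so
countability of `dim V/L` passes to `V ⧸ U n`. Enlarging `L` by more and more lifts of a spanning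
sequence of `V ⧸ L` exhausts `V` by open, linearly bounded subspaces. These are linearly compact
because `V` is complete (`isLinearlyCompact_of_finite_quotient`), and `V` is their colimit and its
own completion.

Conversely, let `V` have a filtration and be the completion of a colimit `C` of linearly compact
spaces. The filtration pulls back to `C`, and a diagonal argument of Baire type
(`exists_isOpen_range`) makes the image of some term of the system open in `C`. Discrete quotients
of linearly compact spaces are finite-dimensional, so this image is linearly bounded. By density of
`C` the corresponding open subspace of `V` is a c-lattice (`exists_isCLattice_of_completion`). It
contains some `U n`, hence has countable codimension. -/

namespace LinTop

/-! ### Open subspaces, filtrations and completeness -/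

section Basics

variable {k : Type u} [Field k]
variable {V : Type v} [AddCommGroup V] [Module k V] [TopologicalSpace V]

/-- An antitone sequence of open linear subspaces which is cofinal among the open subspaces. -/
structure IsFiltration (U : ℕ → Submodule k V) : Prop where
  antitone : Antitone U
  isOpen : ∀ n, IsOpen (U n : Set V)
  exists_le : ∀ W : Submodule k V, IsOpen (W : Set V) → ∃ n, U n ≤ W

theorem discreteTopology_quotient [IsTopologicalAddGroup V] {U : Submodule k V}
    (hU : IsOpen (U : Set V)) : DiscreteTopology (V ⧸ U) :=
  QuotientAddGroup.discreteTopology (N := U.toAddSubgroup) hU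

theorem isOpen_mono [IsTopologicalAddGroup V] {U W : Submodule k V} (h : U ≤ W)
    (hU : IsOpen (U : Set V)) : IsOpen (W : Set V) :=
  AddSubgroup.isOpen_mono (H₁ := U.toAddSubgroup) (H₂ := W.toAddSubgroup) h hU

theorem isClosed_of_isOpen [IsTopologicalAddGroup V] {U : Submodule k V}
    (hU : IsOpen (U : Set V)) : IsClosed (U : Set V) :=
  AddSubgroup.isClosed_of_isOpen U.toAddSubgroup hU

theorem exists_open_submodule_of_mem_nhds [IsTopologicalAddGroup V] [IsLinearTopology k V]
    {x : V} {S : Set V} (hS : S ∈ nhds x) :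
    ∃ U : Submodule k V, IsOpen (U : Set V) ∧ ∀ y, y - x ∈ U → y ∈ S := by
  have h0 : (fun y => y + x) ⁻¹' S ∈ nhds (0 : V) := by
    apply ContinuousAt.preimage_mem_nhds (by fun_prop)
    simpa using hS
  obtain ⟨U, hU, hUS⟩ := (IsLinearTopology.hasBasis_open_submodule k).mem_iff.1 h0
  exact ⟨U, hU, fun y hy => by simpa using hUS hy⟩

theorem mem_of_isClosed [IsTopologicalAddGroup V] [IsLinearTopology k V] {S : Set V}
    (hS : IsClosed S) {x : V}
    (h : ∀ U : Submodule k V, IsOpen (U : Set V) → ∃ y ∈ S, y - x ∈ U) : x ∈ S := by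
  by_contra hx
  obtain ⟨U, hU, hUS⟩ :=
    exists_open_submodule_of_mem_nhds (k := k) (hS.isOpen_compl.mem_nhds hx)
  obtain ⟨y, hy, hyU⟩ := h U hU
  exact hUS y hyU hy

variable (k) in
theorem eq_zero_of_forall_mem [IsTopologicalAddGroup V] [IsLinearTopology k V] [T2Space V] {x : V}
    (h : ∀ U : Submodule k V, IsOpen (U : Set V) → x ∈ U) : x = 0 :=
  mem_of_isClosed (k := k) (isClosed_singleton (x := (0 : V)))
    fun U hU => ⟨0, rfl, by simpa using h U hU⟩

theorem HasCountableBasis.exists_isFiltration [IsTopologicalAddGroup V]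
    (h : HasCountableBasis k V) : ∃ U : ℕ → Submodule k V, IsFiltration U := by
  obtain ⟨B, hBc, hB⟩ := h
  have : (nhds (0 : V)).IsCountablyGenerated :=
    Filter.HasCountableBasis.isCountablyGenerated ⟨hB, hBc⟩
  obtain ⟨U, hUB, hU⟩ := hB.exists_antitone_subbasis
  refine ⟨U, fun m n hmn => hU.2 hmn, fun n => ?_, fun W hW => ?_⟩
  · exact (U n).toAddSubgroup.isOpen_of_mem_nhds (hB.mem_of_mem (hUB n))
  · obtain ⟨n, -, hn⟩ := hU.1.mem_iff.1 (hW.mem_nhds W.zero_mem)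
    exact ⟨n, hn⟩

theorem IsFiltration.hasCountableBasis [IsTopologicalAddGroup V] [IsLinearTopology k V]
    {U : ℕ → Submodule k V} (hU : IsFiltration U) : HasCountableBasis k V := by
  refine ⟨Set.range U, Set.countable_range U, ⟨fun S => ⟨fun hS => ?_, ?_⟩⟩⟩
  · obtain ⟨W, hW, hWS⟩ := (IsLinearTopology.hasBasis_open_submodule k).mem_iff.1 hS
    obtain ⟨n, hn⟩ := hU.exists_le W hW
    exact ⟨U n, ⟨n, rfl⟩, fun x hx => hWS (hn hx)⟩
  · rintro ⟨_, ⟨n, rfl⟩, hn⟩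
    exact Filter.mem_of_superset ((hU.isOpen n).mem_nhds (U n).zero_mem) hn

theorem isLinearTopology_of_exists [ContinuousAdd V]
    (h : ∀ S ∈ nhds (0 : V), ∃ U : Submodule k V, IsOpen (U : Set V) ∧ (U : Set V) ⊆ S) :
    IsLinearTopology k V := by
  refine IsLinearTopology.mk_of_hasBasis k
    (p := fun U : Submodule k V => IsOpen (U : Set V)) (s := id) ⟨fun S => ⟨h S, ?_⟩⟩
  rintro ⟨U, hU, hUS⟩
  exact Filter.mem_of_superset (hU.mem_nhds U.zero_mem) hUS

instance isLinearTopology_submodule [IsTopologicalAddGroup V] [IsLinearTopology k V]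
    (L : Submodule k V) : IsLinearTopology k L := by
  refine isLinearTopology_of_exists fun S hS => ?_
  rw [mem_nhds_induced] at hS
  obtain ⟨T, hT, hTS⟩ := hS
  obtain ⟨U, hU, hUT⟩ := (IsLinearTopology.hasBasis_open_submodule k).mem_iff.1 hT
  exact ⟨U.comap L.subtype, hU.preimage continuous_subtype_val, fun x hx => hTS (hUT hx)⟩

theorem IsFiltration.comap_subtype [IsTopologicalAddGroup V] [IsLinearTopology k V]
    {U : ℕ → Submodule k V} (hU : IsFiltration U) (L : Submodule k V) :
    IsFiltration fun n => (U n).comap L.subtype := by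
  refine ⟨fun m n hmn => Submodule.comap_mono (hU.antitone hmn),
    fun n => (hU.isOpen n).preimage continuous_subtype_val, fun W hW => ?_⟩
  obtain ⟨T, hT, hTW⟩ := isOpen_induced_iff.1 hW
  have h0 : (0 : V) ∈ T := by
    have : (0 : L) ∈ ((↑) : L → V) ⁻¹' T := by rw [hTW]; exact W.zero_mem
    exact this
  obtain ⟨W', hW', hWT⟩ := (IsLinearTopology.hasBasis_open_submodule k).mem_iff.1 (hT.mem_nhds h0)
  obtain ⟨n, hn⟩ := hU.exists_le W' hW'
  refine ⟨n, fun x hx => ?_⟩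
  have : x ∈ ((↑) : L → V) ⁻¹' T := hWT (hn hx)
  rw [hTW] at this
  exact this

theorem isOpen_preimage_mkQ [IsTopologicalAddGroup V] {U : Submodule k V}
    (hU : IsOpen (U : Set V)) (S : Set (V ⧸ U)) : IsOpen (U.mkQ ⁻¹' S) := by
  have := discreteTopology_quotient hU
  exact (isOpen_discrete S).preimage U.isOpenQuotientMap_mkQ.continuous

/-! ### Completeness -/

theorem Completion.isOpen_setOf_apply_mem [IsTopologicalAddGroup V] (U : OpenSub k V)
    (S : Set (V ⧸ U.1)) : IsOpen {x : Completion k V | x.1 U ∈ S} := by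
  have := discreteTopology_quotient U.2
  exact (isOpen_discrete S).preimage
    ((continuous_apply U).comp continuous_subtype_val)

/-- A basic neighbourhood constrains finitely many coordinates, and all of these are determined by
the single coordinate at the intersection of the subspaces involved. -/
theorem Completion.exists_of_mem_nhds [IsTopologicalAddGroup V] {x : Completion k V}
    {S : Set (Completion k V)} (hS : S ∈ nhds x) :
    ∃ U : OpenSub k V, ∀ y : Completion k V, y.1 U = x.1 U → y ∈ S := by
  classical
  rw [mem_nhds_induced] at hS
  obtain ⟨T, hT, hTS⟩ := hS
  rw [nhds_pi, Filter.mem_pi'] at hT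
  obtain ⟨I, t, ht, hIt⟩ := hT
  have hopen : IsOpen ((I.inf fun U => U.1 : Submodule k V) : Set V) := by
    rw [Submodule.coe_finsetInf]
    exact isOpen_biInter_finset fun U _ => U.2
  refine ⟨⟨I.inf fun U => U.1, hopen⟩, fun y hy => hTS (hIt fun U hU => ?_)⟩
  have hle : (I.inf fun U => U.1) ≤ U.1 := Finset.inf_le hU
  have h1 := y.2 ⟨_, hopen⟩ U hle
  rw [hy, x.2 ⟨_, hopen⟩ U hle] at h1
  rw [← h1]
  exact mem_of_mem_nhds (ht U)

theorem continuous_toCompletion [IsTopologicalAddGroup V] : Continuous (toCompletion k V) :=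
  Continuous.subtype_mk
    (continuous_pi fun U : OpenSub k V => U.1.isOpenQuotientMap_mkQ.continuous) _

/-- Injectivity is the Hausdorff property. The map is open because, once every point of the
completion comes from `V`, agreeing with `x` at the coordinate `U` means lying in the image of `x +
U`. -/
theorem isComplete_of_surjective [IsTopologicalAddGroup V] [IsLinearTopology k V] [T2Space V]
    (h : Function.Surjective (toCompletion k V)) : IsComplete k V := by
  refine ⟨continuous_toCompletion, fun S hS => ?_, ?_, h⟩
  · rw [isOpen_iff_mem_nhds]
    rintro _ ⟨x, hx, rfl⟩
    obtain ⟨U, hU, hUS⟩ := exists_open_submodule_of_mem_nhds (k := k) (hS.mem_nhds hx)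
    refine Filter.mem_of_superset
      ((Completion.isOpen_setOf_apply_mem (⟨U, hU⟩ : OpenSub k V) {U.mkQ x}).mem_nhds rfl) ?_
    intro y hy
    obtain ⟨z, rfl⟩ := h y
    exact ⟨z, hUS z ((Submodule.Quotient.eq U).1 hy), rfl⟩
  · rw [← LinearMap.ker_eq_bot, LinearMap.ker_eq_bot']
    intro x hx
    refine eq_zero_of_forall_mem k fun U hU => ?_
    have := congrArg (fun y : Completion k V => y.1 ⟨U, hU⟩) hx
    exact (Submodule.Quotient.mk_eq_zero U).1 this

theorem IsFiltration.sub_mem {U : ℕ → Submodule k V} (hU : IsFiltration U) {a : ℕ → V}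
    (ha : ∀ n, a (n + 1) - a n ∈ U n) {m n : ℕ} (hmn : m ≤ n) : a n - a m ∈ U m := by
  induction n, hmn using Nat.le_induction with
  | base => simp
  | succ n hmn ih =>
    have := add_mem (hU.antitone hmn (ha n)) ih
    simpa using this

/-- In a complete space every sequence which is Cauchy with respect to a filtration has a limit. -/
theorem IsComplete.exists_limit {U : ℕ → Submodule k V} (hU : IsFiltration U)
    (h : IsComplete k V) {a : ℕ → V} (ha : ∀ n, a (n + 1) - a n ∈ U n) :
    ∃ x, ∀ n, x - a n ∈ U n := by
  -- Modulo an open `W` the sequence is constant from the index `N W` on; these stable values form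
  -- the point of the completion.
  choose N hN using fun W : OpenSub k V => hU.exists_le W.1 W.2
  have key : ∀ (W : OpenSub k V) (n : ℕ), U n ≤ W.1 → W.1.mkQ (a (N W)) = W.1.mkQ (a n) := by
    intro W n hn
    rw [← sub_eq_zero, ← map_sub, Submodule.mkQ_apply, Submodule.Quotient.mk_eq_zero]
    rcases le_total n (N W) with hle | hle
    · exact hn (hU.sub_mem ha hle)
    · rw [← neg_sub]
      exact neg_mem (hN W (hU.sub_mem ha hle))
  obtain ⟨x, hx⟩ := h.surjective ⟨fun W => W.1.mkQ (a (N W)), fun W W' hWW' =>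
    (key W' (N W) ((hN W).trans hWW')).symm⟩
  refine ⟨x, fun n => ?_⟩
  have h1 := congrArg (fun y : Completion k V => y.1 ⟨U n, hU.isOpen n⟩) hx
  have h2 := key ⟨U n, hU.isOpen n⟩ n le_rfl
  exact (Submodule.Quotient.eq (U n)).1 (Eq.trans h1 h2)

end Basics

/-! ### Linear compactness and the diagonal argument -/

section LinearCompactness

variable {k : Type u} [Field k]
variable {V W : Type v} [AddCommGroup V] [Module k V] [TopologicalSpace V]
  [AddCommGroup W] [Module k W] [TopologicalSpace W]

/-- Linear compactness for families of nonempty closed cosets which are directed downwards. -/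
theorem IsLinearlyCompact.nonempty_iInter (h : IsLinearlyCompact k V) {ι : Type*} [Nonempty ι]
    (S : ι → Set V) (hdir : ∀ i j, ∃ l, S l ⊆ S i ∧ S l ⊆ S j)
    (hS : ∀ i, IsClosed (S i) ∧ ∃ (x : V) (H : Submodule k V), S i = (fun h => x + h) '' (H : Set V)) :
    (⋂ i, S i).Nonempty := by
  rw [← Set.sInter_range]
  refine h _ (by rintro _ ⟨i, rfl⟩; exact hS i) fun T hT hfin => ?_
  have : ∃ i, S i ⊆ ⋂₀ T := by
    induction T, hfin using Set.Finite.induction_on with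
    | empty => exact ⟨Classical.arbitrary ι, by simp⟩
    | insert _ _ ih =>
      obtain ⟨i, hi⟩ := ih ((Set.subset_insert _ _).trans hT)
      obtain ⟨j, hj⟩ := hT (Set.mem_insert _ _)
      obtain ⟨l, hli, hlj⟩ := hdir i j
      refine ⟨l, ?_⟩
      rw [Set.sInter_insert]
      exact Set.subset_inter (hj ▸ hlj) (hli.trans hi)
  obtain ⟨i, hi⟩ := this
  obtain ⟨-, x, H, hx⟩ := hS i
  exact ⟨x, hi (hx ▸ ⟨0, H.zero_mem, add_zero x⟩)⟩

/-- The image of a linearly compact space under a continuous linear map is closed. -/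
theorem IsLinearlyCompact.isClosed_range [IsTopologicalAddGroup V] [IsTopologicalAddGroup W]
    [IsLinearTopology k W] [T2Space W] (h : IsLinearlyCompact k V) (f : V →L[k] W) :
    IsClosed (LinearMap.range (f : V →ₗ[k] W) : Set W) := by
  rw [← closure_subset_iff_isClosed]
  intro x hx
  have hne : ∀ U : OpenSub k W, ∃ v, f v - x ∈ U.1 := by
    intro U
    have hopen : IsOpen ((fun y => y - x) ⁻¹' (U.1 : Set W)) := U.2.preimage (by fun_prop)
    obtain ⟨_, hy, v, rfl⟩ := mem_closure_iff.1 hx _ hopen (by simp)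
    exact ⟨v, hy⟩
  have : Nonempty (OpenSub k W) := ⟨⟨⊤, isOpen_univ⟩⟩
  suffices hv : (⋂ U : OpenSub k W, {v | f v - x ∈ U.1}).Nonempty by
    obtain ⟨v, hv⟩ := hv
    refine ⟨v, ?_⟩
    rw [← sub_eq_zero]
    exact eq_zero_of_forall_mem k fun U hU => Set.mem_iInter.1 hv ⟨U, hU⟩
  refine h.nonempty_iInter _ ?_ ?_
  · intro U U'
    refine ⟨⟨U.1 ⊓ U'.1, U.2.inter U'.2⟩, fun v hv => hv.1, fun v hv => hv.2⟩
  · intro U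
    refine ⟨(isClosed_of_isOpen U.2).preimage (by fun_prop), ?_⟩
    obtain ⟨v, hv⟩ := hne U
    refine ⟨v, U.1.comap (f : V →ₗ[k] W), Set.ext fun w => ⟨fun hw => ⟨w - v, ?_, by simp⟩, ?_⟩⟩
    · have := sub_mem hw hv
      simpa using this
    · rintro ⟨w, hw, rfl⟩
      have := add_mem (show f w ∈ U.1 from hw) hv
      change f (v + w) - x ∈ U.1
      rwa [map_add, add_sub_right_comm, add_comm]

/-- A linearly compact space has finite-dimensional discrete quotients. -/
theorem IsLinearlyCompact.finite_quotient [IsTopologicalAddGroup V] (h : IsLinearlyCompact k V)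
    {U : Submodule k V} (hU : IsOpen (U : Set V)) : Module.Finite k (V ⧸ U) := by
  classical
  let b := Module.Basis.ofVectorSpace k (V ⧸ U)
  by_contra hfin
  have hinf : Infinite (Module.Basis.ofVectorSpaceIndex k (V ⧸ U)) := by
    by_contra hI
    rw [not_infinite_iff_finite] at hI
    exact hfin (Module.Finite.of_basis b)
  -- A common point of these cosets would have every coordinate equal to `1`, impossible for a
  -- finitely supported vector when the basis is infinite.
  let S : Finset (Module.Basis.ofVectorSpaceIndex k (V ⧸ U)) → Set V :=
    fun s => {v | ∀ i ∈ s, b.repr (U.mkQ v) i = 1}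
  suffices hv : (⋂ s, S s).Nonempty by
    obtain ⟨v, hv⟩ := hv
    obtain ⟨i, hi⟩ := Infinite.exists_notMem_finset (b.repr (U.mkQ v)).support
    have := Set.mem_iInter.1 hv {i} i (Finset.mem_singleton_self i)
    rw [Finsupp.notMem_support_iff.1 hi] at this
    exact zero_ne_one this
  refine h.nonempty_iInter S ?_ ?_
  · exact fun s t => ⟨s ∪ t, fun v hv i hi => hv i (Finset.mem_union_left _ hi),
      fun v hv i hi => hv i (Finset.mem_union_right _ hi)⟩
  · intro s
    have hcl : IsClosed (S s) := by
      rw [← isOpen_compl_iff]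
      exact isOpen_preimage_mkQ hU {q | ¬ ∀ i ∈ s, b.repr q i = 1}
    obtain ⟨x, hx⟩ := U.mkQ_surjective (∑ i ∈ s, b i)
    have hxs : x ∈ S s := by
      intro i hi
      rw [hx, map_sum, Finsupp.finsetSum_apply]
      simp [Finsupp.single_apply, hi]
    let H : Submodule k V :=
      { carrier := {v | ∀ i ∈ s, b.repr (U.mkQ v) i = 0}
        add_mem' := fun ha hb i hi => by rw [map_add, map_add, Finsupp.add_apply, ha i hi, hb i hi, add_zero]
        zero_mem' := fun i _ => by rw [map_zero, map_zero, Finsupp.zero_apply]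
        smul_mem' := fun c v hv i hi => by rw [map_smul, map_smul, Finsupp.smul_apply, hv i hi, smul_zero] }
    refine ⟨hcl, x, H, Set.ext fun w => ⟨fun hw => ⟨w - x, fun i hi => ?_, by simp⟩, ?_⟩⟩
    · rw [map_sub, map_sub, Finsupp.sub_apply, hw i hi, hxs i hi, sub_self]
    · rintro ⟨w, hw, rfl⟩ i hi
      rw [map_add, map_add, Finsupp.add_apply, hw i hi, hxs i hi, add_zero]

/-- A space which is complete along a filtration with finite-dimensional quotients is linearly
compact. -/
theorem isLinearlyCompact_of_finite_quotient [IsTopologicalAddGroup V] [IsLinearTopology k V]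
    {U : ℕ → Submodule k V} (hU : IsFiltration U)
    (hlim : ∀ a : ℕ → V, (∀ n, a (n + 1) - a n ∈ U n) → ∃ x, ∀ n, x - a n ∈ U n)
    (hfin : ∀ n, Module.Finite k (V ⧸ U n)) : IsLinearlyCompact k V := by
  intro 𝒮 h𝒮 hne
  -- finite intersections of members of `𝒮`, together with a direction
  let F : Set (Set V × Submodule k V) :=
    {p | (∃ T ⊆ 𝒮, T.Finite ∧ p.1 = ⋂₀ T) ∧ ∃ x, p.1 = (fun h => x + h) '' (p.2 : Set V)}
  have hcoset : ∀ {S : Set V} {x : V} {H : Submodule k V}, S = (fun h => x + h) '' (H : Set V) →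
      ∀ {y}, y ∈ S → ∀ z, z ∈ S ↔ z - y ∈ H := by
    rintro _ x H rfl _ ⟨y, hy, rfl⟩ z
    constructor
    · rintro ⟨z, hz, rfl⟩
      simpa using sub_mem hz hy
    · intro hz
      refine ⟨z - x, ?_, by simp⟩
      have := add_mem hz hy
      simp only [← sub_sub, sub_add_cancel] at this
      exact this
  have hnonempty : ∀ p ∈ F, p.1.Nonempty := by
    rintro p ⟨⟨T, hT, hTf, hp⟩, -⟩
    exact hp ▸ hne T hT hTf
  have hinter : ∀ p ∈ F, ∀ q ∈ F, (p.1 ∩ q.1, p.2 ⊓ q.2) ∈ F := by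
    rintro p ⟨⟨T, hT, hTf, hp⟩, x, hx⟩ q ⟨⟨T', hT', hTf', hq⟩, x', hx'⟩
    have hI : p.1 ∩ q.1 = ⋂₀ (T ∪ T') := by rw [hp, hq, Set.sInter_union]
    refine ⟨⟨T ∪ T', Set.union_subset hT hT', hTf.union hTf', hI⟩, ?_⟩
    obtain ⟨y, hy⟩ : (p.1 ∩ q.1).Nonempty :=
      hI ▸ hne _ (Set.union_subset hT hT') (hTf.union hTf')
    refine ⟨y, Set.ext fun z => ?_⟩
    rw [Set.mem_inter_iff, hcoset hx hy.1, hcoset hx' hy.2]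
    refine ⟨fun hz => ⟨z - y, hz, by simp⟩, ?_⟩
    rintro ⟨w, hw, rfl⟩
    simpa using hw
  have hsingle : ∀ S ∈ 𝒮, ∃ H, (S, H) ∈ F := by
    intro S hS
    obtain ⟨-, x, H, hx⟩ := h𝒮 S hS
    exact ⟨H, ⟨{S}, by simpa using hS, Set.finite_singleton S, by simp⟩, x, hx⟩
  have hF : F.Nonempty :=
    ⟨(Set.univ, ⊤), ⟨∅, by simp, Set.finite_empty, by simp⟩, 0, by simp⟩
  -- members whose image in `V / U n` is minimal
  have hmin : ∀ n, ∃ p ∈ F, ∀ q ∈ F, ∀ t ∈ p.1, ∃ t' ∈ p.1 ∩ q.1, t' - t ∈ U n := by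
    intro n
    have := hfin n
    -- Finite dimension of `V ⧸ U n` gives the descending chain condition. By minimality,
    -- intersecting with a further `q` does not shrink the image of the direction.
    obtain ⟨_, ⟨p, hp, rfl⟩, hpmin⟩ := WellFounded.has_min
      (wellFounded_lt (α := Submodule k (V ⧸ U n)))
      ((fun p : Set V × Submodule k V => p.2.map (U n).mkQ) '' F) (hF.image _)
    refine ⟨p, hp, fun q hq t ht => ?_⟩
    have hpq := hinter p hp q hq
    obtain ⟨y, hy⟩ := hnonempty _ hpq
    have hle : (p.2 ⊓ q.2).map (U n).mkQ ≤ p.2.map (U n).mkQ := Submodule.map_mono inf_le_left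
    have heq : (p.2 ⊓ q.2).map (U n).mkQ = p.2.map (U n).mkQ := by
      by_contra hne'
      exact hpmin _ ⟨_, hpq, rfl⟩ (lt_of_le_of_ne hle hne')
    obtain ⟨x, hx⟩ := hp.2
    have hty : (U n).mkQ (t - y) ∈ p.2.map (U n).mkQ :=
      Submodule.mem_map_of_mem ((hcoset hx hy.1 t).1 ht)
    rw [← heq] at hty
    obtain ⟨w, hw, hwt⟩ := hty
    refine ⟨y + w, ?_, ?_⟩
    · obtain ⟨x, hx⟩ := hpq.2
      exact (hcoset hx hy _).2 (by simpa using hw)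
    · have := (Submodule.Quotient.eq (U n)).1 hwt
      convert this using 1
      abel
  choose p hpF hp using hmin
  have hstep : ∀ (n : ℕ) (t : (p n).1), ∃ t' : (p (n + 1)).1, (t' : V) - t ∈ U n := by
    intro n t
    obtain ⟨t', ht', h⟩ := hp n _ (hpF (n + 1)) t t.2
    exact ⟨⟨t', ht'.2⟩, h⟩
  choose next hnext using hstep
  obtain ⟨a₀, ha₀⟩ := hnonempty _ (hpF 0)
  obtain ⟨a, ha⟩ : ∃ a : ∀ n, (p n).1, ∀ n, (a (n + 1)).1 - (a n).1 ∈ U n :=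
    ⟨fun n => Nat.rec (motive := fun n => (p n).1) ⟨a₀, ha₀⟩ next n, fun n => hnext n _⟩
  obtain ⟨x, hx⟩ := hlim (fun n => (a n).1) ha
  -- Each `S` meets `a n + U n` by minimality of `p n`, and this coset is `x + U n`; closedness then
  -- puts `x` in `S`.
  refine ⟨x, fun S hS => mem_of_isClosed (k := k) (h𝒮 S hS).1 fun O hO => ?_⟩
  obtain ⟨n, hn⟩ := hU.exists_le O hO
  obtain ⟨H, hH⟩ := hsingle S hS
  obtain ⟨t', ht', h⟩ := hp n _ hH (a n) (a n).2
  refine ⟨t', ht'.2, hn ?_⟩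
  have := sub_mem h (hx n)
  simpa using this

/-- An open linearly bounded subspace of a complete space with a filtration is linearly compact. -/
theorem IsLinearlyBounded.isLinearlyCompact [IsTopologicalAddGroup V] [IsLinearTopology k V]
    {U : ℕ → Submodule k V} (hU : IsFiltration U) (hV : IsComplete k V) {L : Submodule k V}
    (hLo : IsOpen (L : Set V)) (hL : IsLinearlyBounded L) : IsLinearlyCompact k L := by
  refine isLinearlyCompact_of_finite_quotient (hU.comap_subtype L) (fun a ha => ?_)
    fun n => hL _ (hU.isOpen n)
  obtain ⟨x, hx⟩ := hV.exists_limit hU (a := fun n => (a n : V)) ha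
  obtain ⟨n, hn⟩ := hU.exists_le L hLo
  have hxL : x ∈ L := by
    have := add_mem (hn (hx n)) (a n).2
    simpa using this
  exact ⟨⟨x, hxL⟩, hx⟩

/-- Let `C` be the union of an increasing sequence of images of linearly compact spaces `A i`, with
the finest linear topology making the maps from the `A i` continuous. If `C` has a filtration then
one of the images is open. -/
theorem exists_isOpen_range {A : ℕ → Type v} [∀ i, AddCommGroup (A i)] [∀ i, Module k (A i)]
    [∀ i, TopologicalSpace (A i)] [∀ i, IsTopologicalAddGroup (A i)]
    [IsTopologicalAddGroup V] [IsLinearTopology k V] [T2Space V]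
    (hA : ∀ i, IsLinearlyCompact k (A i)) (f : ∀ i, A i →L[k] V)
    (hmono : Monotone fun i => LinearMap.range (f i : A i →ₗ[k] V))
    (hopen : ∀ W : Submodule k V, (∀ i, IsOpen (f i ⁻¹' (W : Set V))) → IsOpen (W : Set V))
    {U : ℕ → Submodule k V} (hU : IsFiltration U) :
    ∃ i, IsOpen (LinearMap.range (f i : A i →ₗ[k] V) : Set V) := by
  by_contra! hcon
  set L := fun i => LinearMap.range (f i : A i →ₗ[k] V)
  -- The points `x n` tend to `0`. The contradiction will be an open subspace, the union of a chain
  -- `W i`, that contains none of them.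
  have hx : ∀ n, ∃ x ∈ U n, x ∉ L n := by
    intro n
    by_contra! h
    exact hcon n (isOpen_mono (fun x hx => h x hx) (hU.isOpen n))
  choose x hxU hxL using hx
  let P : ℕ → Submodule k V → Prop := fun i W =>
    IsClosed (W : Set V) ∧ W ≤ L i ∧ IsOpen (f i ⁻¹' (W : Set V)) ∧ ∀ n, x n ∉ W
  have hLcl : ∀ i, IsClosed (L i : Set V) := fun i => (hA i).isClosed_range (f i)
  have hstep : ∀ i (W : {W // P i W}), ∃ W' : {W // P (i + 1) W}, W.1 ≤ W'.1 := by
    rintro i ⟨W, hWcl, hWL, -, hxW⟩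
    -- A closed subspace is the intersection of its open enlargements `W ⊔ O`.
    have hO : ∀ n, ∃ O : Submodule k V, IsOpen (O : Set V) ∧ x n ∉ W ⊔ O := by
      intro n
      by_contra! h
      refine hxW n (mem_of_isClosed (k := k) hWcl fun O hO => ?_)
      obtain ⟨w, hw, o, ho, hwo⟩ := Submodule.mem_sup.1 (h O hO)
      exact ⟨w, hw, by rw [← hwo]; simpa using ho⟩
    choose O hOo hxO using hO
    -- Only `n ≤ i` has to be avoided by the enlargement, so finitely many `O n` suffice. For `n ≥ i
    -- + 1`, intersecting with `L (i + 1) ≤ L n` already excludes `x n`.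
    let Q := (Finset.range (i + 1)).inf O
    have hQ : IsOpen (Q : Set V) := by
      rw [Submodule.coe_finsetInf]
      exact isOpen_biInter_finset fun n _ => hOo n
    have hWQ : IsOpen ((W ⊔ Q : Submodule k V) : Set V) := isOpen_mono le_sup_right hQ
    refine ⟨⟨(W ⊔ Q) ⊓ L (i + 1), (isClosed_of_isOpen hWQ).inter (hLcl _), inf_le_right, ?_, ?_⟩,
      le_inf le_sup_left (hWL.trans (hmono i.le_succ))⟩
    · have : f (i + 1) ⁻¹' (((W ⊔ Q) ⊓ L (i + 1) : Submodule k V) : Set V) =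
          f (i + 1) ⁻¹' ((W ⊔ Q : Submodule k V) : Set V) := by
        ext y
        exact ⟨fun h => h.1, fun h => ⟨h, y, rfl⟩⟩
      rw [this]
      exact hWQ.preimage (f (i + 1)).continuous
    · rintro n ⟨hn, hnL⟩
      rcases lt_or_ge n (i + 1) with hlt | hge
      · exact hxO n (sup_le_sup_left (Finset.inf_le (Finset.mem_range.2 hlt)) W hn)
      · exact hxL n (hmono hge hnL)
  choose next hnext using hstep
  have h0 : P 0 (L 0) := by
    refine ⟨hLcl 0, le_rfl, ?_, fun n hn => hxL n (hmono (Nat.zero_le n) hn)⟩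
    convert isOpen_univ
    exact Set.eq_univ_of_forall fun y => ⟨y, rfl⟩
  let W : ∀ i, {W // P i W} := fun i => Nat.rec ⟨L 0, h0⟩ (fun i W => next i W) i
  have hWmono : Monotone fun i => (W i).1 := monotone_nat_of_le_succ fun i => hnext i (W i)
  have hWopen : IsOpen ((⨆ i, (W i).1 : Submodule k V) : Set V) := by
    refine hopen _ fun i => ?_
    exact isOpen_mono (U := (W i).1.comap (f i : A i →ₗ[k] V))
      (W := (⨆ i, (W i).1).comap (f i : A i →ₗ[k] V))
      (Submodule.comap_mono (le_iSup (fun i => (W i).1) i)) (W i).2.2.2.1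
  obtain ⟨n, hn⟩ := hU.exists_le _ hWopen
  obtain ⟨i, hi⟩ := (Submodule.mem_iSup_of_directed _ hWmono.directed_le).1 (hn (hxU n))
  exact (W i).2.2.2.2 n hi

end LinearCompactness

/-! ### Countable dimension and gluing of linear maps -/

section Dimension

variable {k : Type u} [Field k]
variable {V X : Type v} [AddCommGroup V] [Module k V] [AddCommGroup X] [Module k X]

theorem HasCountableDim.of_injective (h : HasCountableDim k X) (f : V →ₗ[k] X)
    (hf : Function.Injective f) : HasCountableDim k V :=
  (LinearMap.rank_le_of_injective f hf).trans h

theorem HasCountableDim.of_surjective (h : HasCountableDim k V) (f : V →ₗ[k] X)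
    (hf : Function.Surjective f) : HasCountableDim k X :=
  (LinearMap.rank_le_of_surjective f hf).trans h

theorem HasCountableDim.exists_span_eq_top (h : HasCountableDim k V) :
    ∃ s : ℕ → V, Submodule.span k (Set.range s) = ⊤ := by
  let b := Module.Basis.ofVectorSpace k V
  have hc : Countable (Module.Basis.ofVectorSpaceIndex k V) := by
    rw [← Cardinal.mk_le_aleph0_iff, b.mk_eq_rank'']
    exact h
  obtain ⟨s, hs⟩ := Set.countable_iff_exists_subset_range.1 (Set.countable_range b)
  exact ⟨s, top_le_iff.1 (b.span_eq ▸ Submodule.span_mono hs)⟩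

/-- `V ⧸ U` is an extension of a quotient of `V ⧸ L` by the finite-dimensional image of `L`. -/
theorem HasCountableDim.quotient_of_finite_map {L U : Submodule k V}
    (hL : HasCountableDim k (V ⧸ L)) (hfin : Module.Finite k (L.map U.mkQ)) :
    HasCountableDim k (V ⧸ U) := by
  have h1 : HasCountableDim k ((V ⧸ U) ⧸ L.map U.mkQ) := by
    refine hL.of_surjective (Submodule.mapQ L (L.map U.mkQ) U.mkQ (Submodule.le_comap_map _ _)) ?_
    intro x
    obtain ⟨y, rfl⟩ := Submodule.mkQ_surjective _ x
    obtain ⟨z, rfl⟩ := Submodule.mkQ_surjective _ y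
    exact ⟨L.mkQ z, rfl⟩
  have h2 : Module.rank k (L.map U.mkQ) ≤ Cardinal.aleph0 :=
    (Module.rank_lt_aleph0_iff.2 hfin).le
  unfold HasCountableDim
  rw [← Submodule.rank_quotient_add_rank (L.map U.mkQ)]
  exact Cardinal.add_le_aleph0.2 ⟨h1, h2⟩

/-- Compatible linear maps on an exhausting sequence of subspaces glue. -/
theorem exists_linearMap_of_exhausting {M : ℕ → Submodule k V} (hM : Monotone M)
    (htop : ∀ x, ∃ n, x ∈ M n) (g : ∀ n, M n →ₗ[k] X)
    (hg : ∀ m n (h : m ≤ n) (x : M m), g n (Submodule.inclusion (hM h) x) = g m x) :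
    ∃ f : V →ₗ[k] X, ∀ n (x : M n), f x = g n x := by
  choose N hN using htop
  have key : ∀ n (x : M n), g (N x) ⟨x, hN x⟩ = g n x := by
    intro n x
    rcases le_total n (N x) with h | h
    · exact hg n (N x) h x
    · exact (hg (N x) n h ⟨x, hN x⟩).symm
  refine ⟨{ toFun := fun x => g (N x) ⟨x, hN x⟩, map_add' := fun x y => ?_,
            map_smul' := fun c x => ?_ }, key⟩
  · have hx := hM (le_max_left (N x) (N y)) (hN x)
    have hy := hM (le_max_right (N x) (N y)) (hN y)
    rw [key _ ⟨x, hx⟩, key _ ⟨y, hy⟩, key _ ⟨x + y, add_mem hx hy⟩, ← map_add]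
    rfl
  · rw [key _ ⟨c • x, (M (N x)).smul_mem c (hN x)⟩, RingHom.id_apply, ← map_smul]
    rfl

end Dimension

/-! ### Linearly bounded subspaces and lifting to complete spaces -/

section Bounded

variable {k : Type u} [Field k]
variable {V X : Type v} [AddCommGroup V] [Module k V] [TopologicalSpace V]
  [AddCommGroup X] [Module k X]

theorem IsLinearlyBounded.finite_map {L : Submodule k V} (hL : IsLinearlyBounded L)
    (g : V →ₗ[k] X) (hg : IsOpen (LinearMap.ker g : Set V)) : Module.Finite k (L.map g) := by
  have h2 : LinearMap.ker (g.comp L.subtype) = (LinearMap.ker g).comap L.subtype :=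
    LinearMap.ker_comp _ _
  have := hL _ hg
  rw [← h2] at this
  have h1 : LinearMap.range (g.comp L.subtype) = L.map g := by
    rw [LinearMap.range_comp, Submodule.range_subtype]
  rw [← h1]
  exact Module.Finite.equiv (g.comp L.subtype).quotKerEquivRange

theorem isLinearlyBounded_of_finite_map {L : Submodule k V}
    (h : ∀ U : Submodule k V, IsOpen (U : Set V) → Module.Finite k (L.map U.mkQ)) :
    IsLinearlyBounded L := by
  intro U hU
  have := h U hU
  have h1 : LinearMap.range (U.mkQ.comp L.subtype) = L.map U.mkQ := by
    rw [LinearMap.range_comp, Submodule.range_subtype]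
  have h2 : LinearMap.ker (U.mkQ.comp L.subtype) = U.comap L.subtype := by
    rw [LinearMap.ker_comp, Submodule.ker_mkQ]
  rw [← h1] at this
  rw [← h2]
  exact Module.Finite.equiv (U.mkQ.comp L.subtype).quotKerEquivRange.symm

theorem IsLinearlyBounded.finite_map_mkQ {L : Submodule k V} (hL : IsLinearlyBounded L)
    {U : Submodule k V} (hU : IsOpen (U : Set V)) : Module.Finite k (L.map U.mkQ) :=
  hL.finite_map _ (by rwa [Submodule.ker_mkQ])

theorem IsLinearlyBounded.sup_of_finite {L F : Submodule k V} (hL : IsLinearlyBounded L)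
    (hF : Module.Finite k F) : IsLinearlyBounded (L ⊔ F) := by
  refine isLinearlyBounded_of_finite_map fun U hU => ?_
  have := hL.finite_map_mkQ hU
  rw [Submodule.map_sup]
  infer_instance

/-- A subspace of countable codimension which is open and linearly bounded can be enlarged to an
exhausting sequence of such subspaces. -/
theorem IsLinearlyBounded.exists_exhausting [IsTopologicalAddGroup V] {L : Submodule k V}
    (hLo : IsOpen (L : Set V)) (hL : IsLinearlyBounded L) (hdim : HasCountableDim k (V ⧸ L)) :
    ∃ M : ℕ → Submodule k V, Monotone M ∧ (∀ x, ∃ n, x ∈ M n) ∧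
      (∀ n, IsOpen (M n : Set V)) ∧ ∀ n, IsLinearlyBounded (M n) := by
  obtain ⟨s, hs⟩ := hdim.exists_span_eq_top
  choose t ht using fun n => L.mkQ_surjective (s n)
  -- The span of the first `n` lifts: finite-dimensional, and jointly with `L` exhausting `V`.
  let F : ℕ → Submodule k V := fun n => Submodule.span k (t '' Set.Iio n)
  have hFmono : Monotone F := fun m n h =>
    Submodule.span_mono (Set.image_mono (Set.Iio_subset_Iio h))
  refine ⟨fun n => L ⊔ F n, fun m n h => sup_le_sup_left (hFmono h) L, fun x => ?_,
    fun n => isOpen_mono le_sup_left hLo, fun n => hL.sup_of_finite ?_⟩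
  · have hx : L.mkQ x ∈ Submodule.map L.mkQ (Submodule.span k (Set.range t)) := by
      rw [Submodule.map_span, ← Set.range_comp]
      have : ⇑L.mkQ ∘ t = s := funext ht
      rw [this, hs]
      trivial
    obtain ⟨y, hy, hyx⟩ := hx
    have hrange : Set.range t = ⋃ n, t '' Set.Iio n := by
      rw [← Set.image_iUnion, Set.iUnion_Iio, Set.image_univ]
    rw [hrange, Submodule.span_iUnion] at hy
    obtain ⟨n, hn⟩ := (Submodule.mem_iSup_of_directed F hFmono.directed_le).1 hy
    refine ⟨n, Submodule.mem_sup.2 ⟨x - y, ?_, y, hn, by simp⟩⟩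
    exact (Submodule.Quotient.eq L).1 hyx.symm
  · exact Module.Finite.span_of_finite k ((Set.finite_Iio n).image t)

/-- The universal property of a complete space as the limit of its quotients by a filtration. -/
theorem IsComplete.exists_lift [IsTopologicalAddGroup V] [IsLinearTopology k V] [T2Space V]
    [TopologicalSpace X] [IsTopologicalAddGroup X]
    {U : ℕ → Submodule k V} (hU : IsFiltration U) (hV : IsComplete k V)
    (f : ∀ n, X →L[k] V ⧸ U n)
    (hf : ∀ m n (h : m ≤ n) x, Submodule.factor (hU.antitone h) (f n x) = f m x) :
    ∃ g : X →L[k] V, ∀ n x, (U n).mkQ (g x) = f n x := by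
  have hex : ∀ x, ∃ y, ∀ n, (U n).mkQ y = f n x := by
    intro x
    choose a ha using fun n => (U n).mkQ_surjective (f n x)
    obtain ⟨y, hy⟩ := hV.exists_limit hU (a := a) fun n => by
      refine (Submodule.Quotient.eq (U n)).1 ?_
      change (U n).mkQ (a (n + 1)) = (U n).mkQ (a n)
      rw [ha n, ← hf n (n + 1) n.le_succ x, ← ha (n + 1)]
      rfl
    exact ⟨y, fun n => (ha n) ▸ (Submodule.Quotient.eq (U n)).2 (hy n)⟩
  have huniq : ∀ y z : V, (∀ n, (U n).mkQ y = (U n).mkQ z) → y = z := by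
    intro y z h
    rw [← sub_eq_zero]
    refine eq_zero_of_forall_mem k fun W hW => ?_
    obtain ⟨n, hn⟩ := hU.exists_le W hW
    exact hn ((Submodule.Quotient.eq (U n)).1 (h n))
  choose g hg using hex
  let g' : X →ₗ[k] V :=
    { toFun := g
      map_add' := fun x y => huniq _ _ fun n => by rw [map_add, hg, hg, hg, map_add]
      map_smul' := fun c x => huniq _ _ fun n => by
        rw [map_smul, hg, hg, map_smul, RingHom.id_apply] }
  refine ⟨⟨g', ?_⟩, fun n x => hg x n⟩
  refine continuous_of_continuousAt_zero g' ?_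
  rw [ContinuousAt, map_zero, (IsLinearTopology.hasBasis_open_submodule k).tendsto_right_iff]
  intro W hW
  obtain ⟨n, hn⟩ := hU.exists_le W hW
  have := discreteTopology_quotient (hU.isOpen n)
  have h1 : IsOpen (f n ⁻¹' {0}) := (isOpen_discrete _).preimage (f n).continuous
  filter_upwards [h1.mem_nhds (by simp)] with x hx
  refine hn ((Submodule.Quotient.mk_eq_zero (U n)).1 ?_)
  exact (hg x n).trans hx

end Bounded

/-! ### Linear topologies on products -/

section Product

variable {k : Type u} [Field k]

theorem isLinearTopology_pi {J : Type*} {B : J → Type v} [∀ j, AddCommGroup (B j)]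
    [∀ j, Module k (B j)] [∀ j, TopologicalSpace (B j)] [∀ j, IsTopologicalAddGroup (B j)]
    [∀ j, IsLinearTopology k (B j)] : IsLinearTopology k (∀ j, B j) := by
  refine isLinearTopology_of_exists fun S hS => ?_
  rw [nhds_pi, Filter.mem_pi'] at hS
  obtain ⟨I, t, ht, hIt⟩ := hS
  choose U hU hUt using fun j =>
    (IsLinearTopology.hasBasis_open_submodule k).mem_iff.1 (ht j)
  refine ⟨I.inf fun j => (U j).comap (LinearMap.proj j), ?_, fun x hx => hIt fun j hj => ?_⟩
  · rw [Submodule.coe_finsetInf]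
    exact isOpen_biInter_finset fun j _ => (hU j).preimage (continuous_apply j)
  · exact hUt j ((Finset.inf_le hj : (I.inf fun j => (U j).comap (LinearMap.proj j)) ≤ _) hx)

end Product

/-! ### Concrete description of limits and colimits in the category -/

section Categorical

open Opposite

variable {k : Type u} [Field k] [TopologicalSpace k]

instance (A : Space.{v} k) : T2Space A.obj := A.property.1

instance (A : Space.{v} k) : IsLinearTopology k A.obj := A.property.2

variable (k) in
/-- A linearly topologized vector space as an object of the category. -/
abbrev Space.of (V : Type v) [AddCommGroup V] [Module k V] [TopologicalSpace V] [ContinuousAdd V]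
    [ContinuousSMul k V] [T2Space V] [IsLinearTopology k V] : Space.{v} k :=
  ⟨TopModuleCat.of k V, ‹_›, ‹_›⟩

/-- A continuous linear map as a morphism of linearly topologized vector spaces. -/
abbrev Space.ofHom {A B : Space.{v} k} (f : A.obj →L[k] B.obj) : A ⟶ B :=
  ObjectProperty.homMk (ConcreteCategory.ofHom f)

/-- The continuous linear map underlying a morphism. -/
abbrev Space.toCLM {A B : Space.{v} k} (f : A ⟶ B) : A.obj →L[k] B.obj := f.hom.hom

theorem Space.hom_ext {A B : Space.{v} k} {f g : A ⟶ B}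
    (h : ∀ x, Space.toCLM f x = Space.toCLM g x) : f = g := by
  apply ObjectProperty.hom_ext
  ext x
  exact h x

/-! ### Limits of discrete spaces -/

/-- The space of compatible families of elements of a diagram of linearly topologized spaces. -/
def compatibleFamilies {J : Type} [Category J] (F : J ⥤ Space.{v} k) :
    Submodule k (∀ j, (F.obj j).obj) where
  carrier := {x | ∀ (i j : J) (f : i ⟶ j), Space.toCLM (F.map f) (x i) = x j}
  add_mem' hx hy i j f := by rw [Pi.add_apply, map_add, hx i j f, hy i j f, Pi.add_apply]
  zero_mem' i j f := by rw [Pi.zero_apply, map_zero, Pi.zero_apply]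
  smul_mem' c x hx i j f := by rw [Pi.smul_apply, map_smul, hx i j f, Pi.smul_apply]

/-- The compatible families form a cone, whence `l`; uniqueness of maps into the limit makes it a
retraction of the evident map from `A`. Continuity of `l` bounds the topology of `A`: an open
subspace contains the common kernel of finitely many projections. -/
theorem exists_section_of_isLimit {J : Type} [Category J] {F : J ⥤ Space.{v} k} {A : Space.{v} k}
    (π : (Functor.const J).obj A ⟶ F) (h : Limits.IsLimit (Limits.Cone.mk A π)) :
    ∃ l : compatibleFamilies F →L[k] A.obj,
      (∀ x j, Space.toCLM (π.app j) (l x) = x.1 j) ∧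
      ∀ a : A.obj, ∃ x : compatibleFamilies F,
        (∀ j, x.1 j = Space.toCLM (π.app j) a) ∧ l x = a := by
  have : IsLinearTopology k (∀ j, (F.obj j).obj) := isLinearTopology_pi
  let D : Space.{v} k := Space.of k (compatibleFamilies F)
  let c : Limits.Cone F :=
    { pt := D
      π :=
        { app := fun j => Space.ofHom (A := D)
            ((ContinuousLinearMap.proj j).comp (compatibleFamilies F).subtypeL)
          naturality := fun i j f => Space.hom_ext fun x => (x.2 i j f).symm } }
  let l : D ⟶ A := h.lift c
  have hl : ∀ j, l ≫ π.app j = c.π.app j := fun j => h.fac c j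
  have hcompat : ∀ a : A.obj, (fun j => Space.toCLM (π.app j) a) ∈ compatibleFamilies F := by
    intro a i j f
    exact (congrArg (fun g => Space.toCLM g a) (π.naturality f)).symm
  let s : A ⟶ D := Space.ofHom (B := D)
    ((ContinuousLinearMap.pi fun j => Space.toCLM (π.app j)).codRestrict (compatibleFamilies F)
      hcompat)
  have hs : s ≫ l = 𝟙 A := by
    refine h.hom_ext fun j => ?_
    change (s ≫ l) ≫ π.app j = 𝟙 A ≫ π.app j
    rw [Category.assoc, hl, Category.id_comp]
    exact Space.hom_ext fun x => rfl
  refine ⟨Space.toCLM l, fun x j => congrArg (fun g => Space.toCLM g x) (hl j), fun a =>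
    ⟨⟨_, hcompat a⟩, fun j => rfl, congrArg (fun g => Space.toCLM g a) hs⟩⟩

/-- A countable inverse limit of discrete spaces of countable dimension is complete and has a
filtration with quotients of countable dimension. -/
theorem exists_isFiltration_of_proOmegaDiscrete {A : Space.{v} k} (hA : proOmegaDiscrete k A) :
    IsComplete k A.obj ∧ ∃ U : ℕ → Submodule k A.obj, IsFiltration U ∧
      ∀ n, HasCountableDim k (A.obj ⧸ U n) := by
  obtain ⟨P⟩ := hA
  obtain ⟨l, hl, hs⟩ := exists_section_of_isLimit P.π P.isLimit
  let p : ∀ n : ℕ, A.obj →L[k] (P.diag.obj (op n)).obj := fun n => Space.toCLM (P.π.app (op n))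
  let r : ∀ m n : ℕ, m ≤ n → (P.diag.obj (op n)).obj →L[k] (P.diag.obj (op m)).obj :=
    fun m n h => Space.toCLM (P.diag.map (homOfLE h).op)
  have hr : ∀ m n (h : m ≤ n) a, r m n h (p n a) = p m a := fun m n h a =>
    congrArg (fun g => Space.toCLM g a) (P.w (homOfLE h).op)
  let U : ℕ → Submodule k A.obj := fun n => LinearMap.ker (p n).toLinearMap
  have hU : IsFiltration U := by
    refine ⟨fun m n h a ha => ?_, fun n => ?_, fun W hW => ?_⟩
    · change p m a = 0
      rw [← hr m n h, show p n a = 0 from ha, map_zero]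
    · have := (P.prop_diag_obj (op n)).1
      exact (isOpen_discrete {0}).preimage (p n).continuous
    · have h0 : l ⁻¹' (W : Set A.obj) ∈ nhds (0 : compatibleFamilies P.diag) :=
        (hW.preimage l.continuous).mem_nhds (by simp)
      rw [mem_nhds_induced] at h0
      obtain ⟨T, hT, hTW⟩ := h0
      rw [nhds_pi, Filter.mem_pi'] at hT
      obtain ⟨I, t, ht, hIt⟩ := hT
      -- Vanishing of the projection at the largest index in `I` forces vanishing at every index in
      -- `I`.
      refine ⟨I.sup unop, fun a ha => ?_⟩
      obtain ⟨x, hx, rfl⟩ := hs a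
      refine hTW (hIt fun j hj => ?_)
      have hle : j.unop ≤ I.sup unop := Finset.le_sup hj
      have : x.1 j = 0 := by
        rw [hx]
        change p j.unop (l x) = 0
        rw [← hr _ _ hle, show p _ (l x) = 0 from ha, map_zero]
      rw [this]
      exact mem_of_mem_nhds (ht j)
  refine ⟨isComplete_of_surjective fun y => ?_, U, hU, fun n => ?_⟩
  · choose a ha using fun n => (U n).mkQ_surjective (y.1 ⟨U n, hU.isOpen n⟩)
    have hpa : ∀ m n (h : m ≤ n), p m (a n) = p m (a m) := by
      intro m n h
      have h1 := y.2 ⟨U n, hU.isOpen n⟩ ⟨U m, hU.isOpen m⟩ (hU.antitone h)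
      rw [← ha n, ← ha m] at h1
      have h2 : a n - a m ∈ U m := (Submodule.Quotient.eq (U m)).1 h1
      rw [← sub_eq_zero, ← map_sub]
      exact h2
    let x : compatibleFamilies P.diag := ⟨fun j => p j.unop (a j.unop), fun i j f => by
      have h : j.unop ≤ i.unop := leOfHom f.unop
      exact (hr _ _ h _).trans (hpa _ _ h)⟩
    refine ⟨l x, Subtype.ext (funext fun W => ?_)⟩
    obtain ⟨n, hn⟩ := hU.exists_le W.1 W.2
    have h1 := y.2 ⟨U n, hU.isOpen n⟩ W hn
    rw [← ha n] at h1
    rw [← h1]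
    refine (Submodule.Quotient.eq W.1).2 (hn ?_)
    change p n (l x - a n) = 0
    rw [map_sub, sub_eq_zero]
    exact hl x (op n)
  · refine (P.prop_diag_obj (op n)).2.of_injective ((U n).liftQ (p n).toLinearMap le_rfl) ?_
    rw [← LinearMap.ker_eq_bot]
    exact Submodule.ker_liftQ_eq_bot _ _ _ le_rfl

/-! ### Colimits of linearly compact spaces -/

/-- The continuous linear maps of a cocone. -/
abbrev coconeMap {F : ℕ ⥤ Space.{v} k} {C : Space.{v} k} (ι : F ⟶ (Functor.const ℕ).obj C) (n : ℕ) :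
    (F.obj n).obj →L[k] C.obj :=
  Space.toCLM (ι.app n)

theorem coconeMap_map {F : ℕ ⥤ Space.{v} k} {C : Space.{v} k} (ι : F ⟶ (Functor.const ℕ).obj C)
    {m n : ℕ} (f : m ⟶ n) (a : (F.obj m).obj) :
    coconeMap ι n (Space.toCLM (F.map f) a) = coconeMap ι m a :=
  congrArg (fun g => Space.toCLM g a) (ι.naturality f)

theorem monotone_range_coconeMap {F : ℕ ⥤ Space.{v} k} {C : Space.{v} k}
    (ι : F ⟶ (Functor.const ℕ).obj C) :
    Monotone fun n => LinearMap.range (coconeMap ι n).toLinearMap := by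
  rintro m n hmn _ ⟨a, rfl⟩
  exact ⟨Space.toCLM (F.map (homOfLE hmn)) a, coconeMap_map ι _ a⟩

/-- The union of the ranges, with the subspace topology, is itself a cocone. The induced map from
`C` followed by the inclusion is the identity, so the union is all of `C`. -/
theorem exists_mem_range_of_isColimit {F : ℕ ⥤ Space.{v} k} {C : Space.{v} k}
    (ι : F ⟶ (Functor.const ℕ).obj C) (h : Limits.IsColimit (Limits.Cocone.mk C ι)) (x : C.obj) :
    ∃ n, x ∈ LinearMap.range (coconeMap ι n).toLinearMap := by
  let R : ℕ → Submodule k C.obj := fun n =>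
    LinearMap.range (coconeMap ι n).toLinearMap
  have hnat : ∀ m n (f : m ⟶ n) a,
      coconeMap ι n (Space.toCLM (F.map f) a) = Space.toCLM (ι.app m) a :=
    fun m n f a => congrArg (fun g => Space.toCLM g a) (ι.naturality f)
  have hR : Monotone R := by
    rintro m n hmn _ ⟨a, rfl⟩
    exact ⟨Space.toCLM (F.map (homOfLE hmn)) a, hnat _ _ _ a⟩
  let D : Space.{v} k := Space.of k (⨆ n, R n : Submodule k C.obj)
  let c : Limits.Cocone F :=
    { pt := D
      ι :=
        { app := fun n => Space.ofHom (B := D)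
            ((coconeMap ι n).codRestrict (⨆ n, R n)
              fun a => Submodule.mem_iSup_of_mem (p := R) n ⟨a, rfl⟩)
          naturality := fun m n f => Space.hom_ext fun a => Subtype.ext (coconeMap_map ι f a) } }
  let i : D ⟶ C := Space.ofHom (A := D) (⨆ n, R n : Submodule k C.obj).subtypeL
  have hi : h.desc c ≫ i = 𝟙 C := by
    refine h.hom_ext fun n => ?_
    rw [← Category.assoc, h.fac c n]
    exact Space.hom_ext fun a => rfl
  have hx : x ∈ ⨆ n, R n := by
    have := congrArg (fun g => Space.toCLM g x) hi
    change (Space.toCLM (h.desc c) x).1 = x at this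
    rw [← this]
    exact (Space.toCLM (h.desc c) x).2
  exact (Submodule.mem_iSup_of_directed R hR.directed_le).1 hx

/-- The hypothesis says that `C ⧸ W`, made discrete, receives a cocone. The induced continuous map
is the quotient map, so `W` is the preimage of an open point. Discreteness of `k` makes scalar
multiplication on `C ⧸ W` continuous. -/
theorem isOpen_of_isColimit {F : ℕ ⥤ Space.{v} k} {C : Space.{v} k}
    (ι : F ⟶ (Functor.const ℕ).obj C) (h : Limits.IsColimit (Limits.Cocone.mk C ι))
    [DiscreteTopology k]
    (W : Submodule k C.obj) (hW : ∀ n, IsOpen (coconeMap ι n ⁻¹' (W : Set C.obj))) :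
    IsOpen (W : Set C.obj) := by
  let _ : TopologicalSpace (C.obj ⧸ W) := ⊥
  have : DiscreteTopology (C.obj ⧸ W) := ⟨rfl⟩
  have : ContinuousSMul k (C.obj ⧸ W) := ⟨continuous_of_discreteTopology⟩
  let Q : Space.{v} k := Space.of k (C.obj ⧸ W)
  let q : ∀ n, (F.obj n).obj →L[k] C.obj ⧸ W := fun n =>
    ⟨W.mkQ.comp (coconeMap ι n).toLinearMap, by
      refine continuous_of_continuousAt_zero
        (W.mkQ.comp (coconeMap ι n).toLinearMap) ?_
      rw [ContinuousAt, map_zero, nhds_discrete (C.obj ⧸ W), Filter.tendsto_pure]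
      filter_upwards [(hW n).mem_nhds (by simp)] with x hx
      exact (Submodule.Quotient.mk_eq_zero W).2 hx⟩
  let c : Limits.Cocone F :=
    { pt := Q
      ι :=
        { app := fun n => Space.ofHom (B := Q) (q n)
          naturality := fun m n f => Space.hom_ext fun a => congrArg W.mkQ
            (coconeMap_map ι f a) } }
  let g : C.obj →L[k] C.obj ⧸ W := Space.toCLM (h.desc c)
  have hg : ∀ x, g x = W.mkQ x := by
    intro x
    obtain ⟨n, a, rfl⟩ := exists_mem_range_of_isColimit ι h x
    exact congrArg (fun f => Space.toCLM f a) (h.fac c n)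
  have : (W : Set C.obj) = g ⁻¹' {0} := by
    ext x
    rw [Set.mem_preimage, hg, Set.mem_singleton_iff, Submodule.mkQ_apply,
      Submodule.Quotient.mk_eq_zero, SetLike.mem_coe]
  rw [this]
  exact (isOpen_discrete _).preimage g.continuous

/-- A countable colimit of linearly compact spaces which has a countable basis contains an open
linearly bounded subspace. -/
theorem exists_isLinearlyBounded_of_colimit [DiscreteTopology k] {C : Space.{v} k}
    (hC : (linearlyCompactOmega.{v} k).colimitsOfShape ℕ C) {U : ℕ → Submodule k C.obj}
    (hU : IsFiltration U) :
    ∃ L : Submodule k C.obj, IsOpen (L : Set C.obj) ∧ IsLinearlyBounded L := by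
  obtain ⟨P⟩ := hC
  obtain ⟨n, hn⟩ := exists_isOpen_range (fun n => (P.prop_diag_obj n).1)
    (fun n => coconeMap P.ι n) 
    (monotone_range_coconeMap P.ι) (fun W hW => isOpen_of_isColimit P.ι P.isColimit W hW) hU
  refine ⟨_, hn, isLinearlyBounded_of_finite_map fun W hW => ?_⟩
  have h1 := (P.prop_diag_obj n).1.finite_quotient
    (U := W.comap (coconeMap P.ι n).toLinearMap)
    (hW.preimage (coconeMap P.ι n).continuous)
  have h2 : LinearMap.ker (W.mkQ.comp (coconeMap P.ι n).toLinearMap) =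
      W.comap (coconeMap P.ι n).toLinearMap := by
    rw [LinearMap.ker_comp, Submodule.ker_mkQ]
  rw [← h2] at h1
  rw [← LinearMap.range_comp]
  exact Module.Finite.equiv (LinearMap.quotKerEquivRange _)

end Categorical

/-! ### Passage to the completion and the two inclusions -/

section Comparison

open Opposite

variable {k : Type u} [Field k]

/-- Let `V` be a space with a filtration which is isomorphic to the completion of `C`. If the
existence of a filtration on `C` forces an open linearly bounded subspace of `C`, then `V` admits a
c-lattice. -/
theorem exists_isCLattice_of_completion {V C : Type v}
    [AddCommGroup V] [Module k V] [TopologicalSpace V] [IsTopologicalAddGroup V]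
    [IsLinearTopology k V] [AddCommGroup C] [Module k C] [TopologicalSpace C]
    [IsTopologicalAddGroup C] (e : V ≃L[k] Completion k C) {U : ℕ → Submodule k V}
    (hU : IsFiltration U)
    (hC : ∀ U : ℕ → Submodule k C, IsFiltration U →
      ∃ L : Submodule k C, IsOpen (L : Set C) ∧ IsLinearlyBounded L) :
    ∃ M : Submodule k V, IsCLattice M := by
  let j : C →ₗ[k] V := e.symm.toLinearMap.comp (toCompletion k C)
  have hj : Continuous j := e.symm.continuous.comp continuous_toCompletion
  have hej : ∀ c, e (j c) = toCompletion k C c := fun c => e.apply_symm_apply _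
  -- The extension of `W` to the completion: the kernel of the coordinate at `W`, whose preimage
  -- under `j` is `W`.
  let T : OpenSub k C → Submodule k V := fun W =>
    { carrier := {x | (e x).1 W = 0}
      add_mem' := fun {x y} hx hy => by
        change (e (x + y)).1 W = 0
        rw [map_add]
        change (e x).1 W + (e y).1 W = 0
        rw [show (e x).1 W = 0 from hx, show (e y).1 W = 0 from hy, add_zero]
      zero_mem' := by
        change (e 0).1 W = 0
        rw [map_zero]
        rfl
      smul_mem' := fun c x hx => by
        change (e (c • x)).1 W = 0
        rw [map_smul]
        change c • (e x).1 W = 0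
        rw [show (e x).1 W = 0 from hx, smul_zero] }
  have hT : ∀ W, IsOpen (T W : Set V) := fun W =>
    (Completion.isOpen_setOf_apply_mem W {0}).preimage e.continuous
  have hjT : ∀ W c, j c ∈ T W ↔ c ∈ W.1 := by
    intro W c
    change (e (j c)).1 W = 0 ↔ c ∈ W.1
    rw [hej]
    exact Submodule.Quotient.mk_eq_zero W.1
  have hUC : IsFiltration fun n => (U n).comap j := by
    refine ⟨fun m n h => Submodule.comap_mono (hU.antitone h), fun n => (hU.isOpen n).preimage hj,
      fun W hW => ?_⟩
    obtain ⟨n, hn⟩ := hU.exists_le _ (hT ⟨W, hW⟩)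
    exact ⟨n, fun c hc => (hjT ⟨W, hW⟩ c).1 (hn hc)⟩
  obtain ⟨L, hLo, hL⟩ := hC _ hUC
  have hM := hT ⟨L, hLo⟩
  refine ⟨T ⟨L, hLo⟩, isClosed_of_isOpen hM, hM, isLinearlyBounded_of_finite_map fun W hW => ?_⟩
  have hker : IsOpen (LinearMap.ker (W.mkQ.comp j) : Set C) := by
    rw [LinearMap.ker_comp, Submodule.ker_mkQ]
    exact hW.preimage hj
  have := hL.finite_map _ hker
  refine Submodule.finiteDimensional_of_le (S₂ := L.map (W.mkQ.comp j)) ?_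
  rintro _ ⟨m, hm, rfl⟩
  -- Density of `C`: a point `m` of the extended lattice is approximated by some `j c` modulo both
  -- `W` and the lattice. Then `c ∈ L`, and `m` has the same class modulo `W` as `j c`.
  have hopen : IsOpen {y : Completion k C | e.symm y - m ∈ W ⊓ T ⟨L, hLo⟩} := by
    have h1 : IsOpen ((W ⊓ T ⟨L, hLo⟩ : Submodule k V) : Set V) := hW.inter hM
    exact h1.preimage (e.symm.continuous.sub continuous_const)
  obtain ⟨O, hO⟩ := Completion.exists_of_mem_nhds (hopen.mem_nhds (x := e m) (by simp))
  obtain ⟨c, hc⟩ := O.1.mkQ_surjective ((e m).1 O)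
  have hcm : j c - m ∈ W ⊓ T ⟨L, hLo⟩ := hO (toCompletion k C c) hc
  refine ⟨c, (hjT ⟨L, hLo⟩ c).1 ?_, (Submodule.Quotient.eq W).2 hcm.1⟩
  have := add_mem hcm.2 hm
  simpa using this

variable [TopologicalSpace k]

/-- The direct system of members of an increasing sequence of subspaces. -/
def submoduleDiagram (A : Space.{v} k) {M : ℕ → Submodule k A.obj} (hM : Monotone M) :
    ℕ ⥤ Space.{v} k where
  obj n := Space.of k (M n)
  map {m n} f := Space.ofHom (A := Space.of k (M m)) (B := Space.of k (M n))
    ⟨Submodule.inclusion (hM (leOfHom f)), continuous_inclusion (hM (leOfHom f))⟩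
  map_id _ := Space.hom_ext fun _ => rfl
  map_comp _ _ := Space.hom_ext fun _ => rfl

/-- Maps on the members glue linearly. Since `M 0` is open, continuity of the glued map at `0` can
be tested on `M 0` alone. -/
theorem colimitsOfShape_of_exhausting {A : Space.{v} k} {M : ℕ → Submodule k A.obj}
    (hM : Monotone M) (htop : ∀ x, ∃ n, x ∈ M n) (hopen : ∀ n, IsOpen (M n : Set A.obj))
    (hcomp : ∀ n, IsLinearlyCompact k (M n) ∧ HasCountableBasis k (M n)) :
    (linearlyCompactOmega.{v} k).colimitsOfShape ℕ A := by
  let F := submoduleDiagram A hM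
  let ι : F ⟶ (Functor.const ℕ).obj A :=
    { app := fun n => Space.ofHom (A := Space.of k (M n)) (M n).subtypeL
      naturality := fun m n f => Space.hom_ext fun x => rfl }
  have hdesc : ∀ s : Limits.Cocone F, ∃ g : A ⟶ s.pt, ∀ n, ι.app n ≫ g = s.ι.app n := by
    intro s
    let f : ∀ n, M n →L[k] s.pt.obj := fun n => Space.toCLM (s.ι.app n)
    obtain ⟨g, hg⟩ := exists_linearMap_of_exhausting hM htop (fun n => (f n).toLinearMap)
      fun m n h x => congrArg (fun g => Space.toCLM g x) (s.w (homOfLE h))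
    have hcont : Continuous g := by
      refine continuous_of_continuousAt_zero g ?_
      have h1 : ContinuousAt (g ∘ ((↑) : M 0 → A.obj)) 0 :=
        (f 0).continuous.continuousAt.congr (Filter.Eventually.of_forall fun x => (hg 0 x).symm)
      exact ((hopen 0).isOpenEmbedding_subtypeVal.continuousAt_iff (x := (0 : M 0))).1 h1
    exact ⟨Space.ofHom ⟨g, hcont⟩, fun n => Space.hom_ext fun x => hg n x⟩
  choose desc hfac using hdesc
  exact ⟨{
    diag := F
    ι := ι
    isColimit :=
      { desc := desc
        fac := hfac
        uniq := fun s m hm => Space.hom_ext fun x => by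
          obtain ⟨n, hn⟩ := htop x
          exact congrArg (fun g => Space.toCLM g (⟨x, hn⟩ : M n))
            ((hm n).trans (hfac s n).symm) }
    prop_diag_obj := hcomp }⟩

theorem isTateOmega_of_indOmega_of_proOmega [DiscreteTopology k] {A : Space.{v} k}
    (hI : indOmegaLinearlyCompact k A) (hP : proOmegaDiscrete k A) : IsTateOmega k A.obj := by
  obtain ⟨hc, U, hU, hdim⟩ := exists_isFiltration_of_proOmegaDiscrete hP
  obtain ⟨C, hC, ⟨e⟩⟩ := hI
  obtain ⟨M, hM⟩ := exists_isCLattice_of_completion e hU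
    fun U' hU' => exists_isLinearlyBounded_of_colimit hC hU'
  obtain ⟨n, hn⟩ := hU.exists_le M hM.isOpen
  exact ⟨⟨hc, M, hM⟩, hU.hasCountableBasis, M, hM,
    (hdim n).of_surjective (Submodule.factor hn) (Submodule.factor_surjective hn)⟩

/-- The inverse system of quotients by the members of a decreasing sequence of open subspaces. -/
def quotientDiagram (A : Space.{v} k) {U : ℕ → Submodule k A.obj} (hU : IsFiltration U) :
    ℕᵒᵖ ⥤ Space.{v} k where
  obj n :=
    have := discreteTopology_quotient (hU.isOpen n.unop)
    Space.of k (A.obj ⧸ U n.unop)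
  map {m n} f :=
    have := discreteTopology_quotient (hU.isOpen m.unop)
    have := discreteTopology_quotient (hU.isOpen n.unop)
    Space.ofHom (A := Space.of k (A.obj ⧸ U m.unop)) (B := Space.of k (A.obj ⧸ U n.unop))
      ⟨Submodule.factor (hU.antitone (leOfHom f.unop)), continuous_of_discreteTopology⟩
  map_id n := Space.hom_ext fun x => by
    obtain ⟨y, rfl⟩ := Submodule.mkQ_surjective _ x
    rfl
  map_comp f g := Space.hom_ext fun x => by
    obtain ⟨y, rfl⟩ := Submodule.mkQ_surjective _ x
    rfl

theorem proOmegaDiscrete_of_isComplete {A : Space.{v} k} (hA : IsComplete k A.obj)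
    {U : ℕ → Submodule k A.obj} (hU : IsFiltration U)
    (hdim : ∀ n, HasCountableDim k (A.obj ⧸ U n)) : proOmegaDiscrete k A := by
  let F := quotientDiagram A hU
  let q : ∀ n : ℕᵒᵖ, A.obj →L[k] (F.obj n).obj := fun n =>
    ⟨(U n.unop).mkQ, (U n.unop).isOpenQuotientMap_mkQ.continuous⟩
  let π : (Functor.const ℕᵒᵖ).obj A ⟶ F :=
    { app := fun n => Space.ofHom (q n)
      naturality := fun m n f => Space.hom_ext fun x => rfl }
  have hlift : ∀ s : Limits.Cone F, ∃ g : s.pt ⟶ A, ∀ n, g ≫ π.app n = s.π.app n := by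
    intro s
    let f : ∀ n, s.pt.obj →L[k] A.obj ⧸ U n := fun n => Space.toCLM (s.π.app (op n))
    obtain ⟨g, hg⟩ := hA.exists_lift hU f
      fun m n h x => (congrArg (fun g => Space.toCLM g x) (s.w (homOfLE h).op))
    exact ⟨Space.ofHom g, fun n => Space.hom_ext fun x => hg n.unop x⟩
  choose lift hfac using hlift
  exact ⟨{
    diag := F
    π := π
    isLimit :=
      { lift := lift
        fac := hfac
        uniq := fun s m hm => Space.hom_ext fun x => by
          rw [← sub_eq_zero]
          refine eq_zero_of_forall_mem k fun W hW => ?_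
          obtain ⟨n, hn⟩ := hU.exists_le W hW
          refine hn ((Submodule.Quotient.eq (U n)).1 ?_)
          exact congrArg (fun g => Space.toCLM g x) ((hm (op n)).trans (hfac s (op n)).symm) }
    prop_diag_obj := fun n => ⟨discreteTopology_quotient (hU.isOpen n.unop), hdim n.unop⟩ }⟩

theorem indOmega_and_proOmega_of_isTateOmega {A : Space.{v} k} (hA : IsTateOmega k A.obj) :
    indOmegaLinearlyCompact k A ∧ proOmegaDiscrete k A := by
  obtain ⟨⟨hc, -⟩, hb, L, hL, hdim⟩ := hA
  obtain ⟨U, hU⟩ := hb.exists_isFiltration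
  constructor
  · obtain ⟨M, hM, htop, hMo, hMb⟩ := hL.linearlyBounded.exists_exhausting hL.isOpen hdim
    -- The colimit is `A` itself, and completeness identifies it with its completion.
    refine ⟨A, colimitsOfShape_of_exhausting hM htop hMo fun n =>
      ⟨(hMb n).isLinearlyCompact hU hc (hMo n), (hU.comap_subtype (M n)).hasCountableBasis⟩, ⟨?_⟩⟩
    exact
      { LinearEquiv.ofBijective (toCompletion k A.obj) hc.bijective with
        continuous_toFun := hc.continuous
        continuous_invFun := (Equiv.continuous_symm_iff
          (LinearEquiv.ofBijective (toCompletion k A.obj) hc.bijective).toEquiv).2 hc.isOpenMap }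
  · exact proOmegaDiscrete_of_isComplete hc hU fun n =>
      hdim.quotient_of_finite_map (hL.linearlyBounded.finite_map_mkQ (hU.isOpen n))

end Comparison

end LinTop

theorem proposition6p8 (k : Type u) [Field k] [TopologicalSpace k] [DiscreteTopology k] :
    LinTop.indOmegaLinearlyCompact.{v} k ⊓ LinTop.proOmegaDiscrete.{v} k =
      LinTop.tateOmega.{v} k := by
  ext A
  exact ⟨fun h => LinTop.isTateOmega_of_indOmega_of_proOmega h.1 h.2,
    fun h => LinTop.indOmega_and_proOmega_of_isTateOmega h⟩
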